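/- **Setting.** Formulas are built from infinitely many propositional variables and the constant $\bot$ by $\wedge,\vee,\to$; the variables and $\bot$ are the *atoms*; $\Gamma$ ranges over finite sets of formulas. An *atomic rule* infers an atom $a$ from finitely many atomic premises $a_1,\dots,a_k$ and may discharge, above each $a_i$, the atomic rules of a finite set $\Re_i$. Its *level* is $0$ if $k=0$ (an atom used as an axiom), $1$ if $k\ge 1$ and all $\Re_i$ are empty, and $m+2$ if $m$ is the maximal level of the rules in $\bigcup_i\Re_i\neq\emptyset$. A *base* $\mathfrak B$ is a (possibly infinite) set of atomic rules that contains atomic explosion ($a$ from $\bot$) for every atom $a$; $\mathbb B^n$ is the set of the bases all of whose rules, apart from atomic explosion, have level $\le n$; $\mathfrak C\supseteq_n\mathfrak B$ means $\mathfrak B\subseteq\mathfrak C\in\mathbb B^n$; and $\vdash_{\mathfrak B}a$ means that there is a natural deduction derivation of $a$ in which every undischarged rule (level-$0$ rules included) is in $\mathfrak B$. **Sandqvist's consequence.** For $\mathfrak B\in\mathbb B^n$: $\models^s_{\mathfrak B,n}a$ iff $\vdash_{\mathfrak B}a$, for atoms $a$; $\models^s_{\mathfrak B,n}A\wedge B$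 iff $\models^s_{\mathfrak B,n}A$ and $\models^s_{\mathfrak B,n}B$; $\models^s_{\mathfrak B,n}A\vee B$ iff for all $\mathfrak C\supseteq_n\mathfrak B$ and all atoms $d$, $A\models^s_{\mathfrak C,n}d$ and $B\models^s_{\mathfrak C,n}d$ imply $\models^s_{\mathfrak C,n}d$; $\models^s_{\mathfrak B,n}A\to B$ iff $A\models^s_{\mathfrak B,n}B$; and for $\Gamma\neq\emptyset$, $\Gamma\models^s_{\mathfrak B,n}A$ iff for all $\mathfrak C\supseteq_n\mathfrak B$, if $\models^s_{\mathfrak C,n}B$ for all $B\in\Gamma$, then $\models^s_{\mathfrak C,n}A$. **Prawitz's reducibility semantics.** An *argument structure* is a finite rooted tree labelled by formulas, whose top-nodes are either assumptions or atoms used as level-$0$ rules, together with partial functions that assign to an assumption, to a level-$0$ rule or to the application of an atomic rule the node strictly below at which it is discharged; at a node where an atomic rule is discharged, and at a node where a discharged rule is applied, the node and its children are atoms and no assumption is discharged. It is *closed* if all its assumptions are discharged, and it is *from* the set of its undischarged assumptions *to* its root formula. $\mathscr D^\sigma$ is $\mathscr D$ with each undischarged assumption $A$ replaced by an argument structure $\sigma(A)$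 with conclusion $A$. $\mathscr D$ is *canonical* if its last step is one of the introductions of $\wedge,\vee,\to$. A *reduction* is a partial map $\phi$ on argument structures that end with an inference, such that $\phi(\mathscr D)$ has the conclusion of $\mathscr D$ and no other undischarged assumptions than $\mathscr D$, and such that $\phi(\mathscr D^\sigma)=\phi(\mathscr D)^\sigma$ is defined for all $\sigma$ whenever $\phi(\mathscr D)$ is. For a set $\mathfrak J$ of reductions, $\le_{\mathfrak J}$ is the reflexive-transitive closure of replacing a sub-structure by its image under a $\phi\in\mathfrak J$, where what was discharged from outside of the sub-structure is still so discharged if it occurs in the image. For $\mathfrak B\in\mathbb B^n$, $\langle\mathscr D,\mathfrak J\rangle$ is *$n$-valid on $\mathfrak B$* iff: - if $\mathscr D$ is closed with atomic conclusion, then $\mathscr D\le_{\mathfrak J}\mathscr D^*$ for a derivation $\mathscr D^*$ of that atom in $\mathfrak B$, every undischarged rule of which is in $\mathfrak B$; - if $\mathscr D$ is closed with non-atomic conclusion, then $\mathscr D\le_{\mathfrak J}\mathscr D^*$ for a canonical $\mathscr D^*$ all of whose immediate sub-structures are, together with $\mathfrak J$, $n$-valid on $\mathfrak B$; - if $\mathscr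 D$ is open, from $\Gamma$, then for all $\sigma$, all sets of reductions $\mathfrak J^+\supseteq\mathfrak J$ and all $\mathfrak C\supseteq_n\mathfrak B$: if $\sigma(A)$ is closed and $\langle\sigma(A),\mathfrak J^+\rangle$ is $n$-valid on $\mathfrak C$ for all $A\in\Gamma$, then $\langle\mathscr D^\sigma,\mathfrak J^+\rangle$ is $n$-valid on $\mathfrak C$. $\Gamma\models^\alpha_{\mathfrak B,n}A$ means that there is a $\langle\mathscr D,\mathfrak J\rangle$ with $\mathscr D$ from $\Gamma$ to $A$ that is $n$-valid on $\mathfrak B$. **Theorem 10.** For $n=2$, neither of the two consequence relations is included in the other base-wise: both of the following statements are false. 1. For all $\Gamma$, all $A$ and all $\mathfrak B\in\mathbb B^2$: if $\Gamma\models^s_{\mathfrak B,2}A$, then $\Gamma\models^\alpha_{\mathfrak B,2}A$. 2. For all $\Gamma$, all $A$ and all $\mathfrak B\in\mathbb B^2$: if $\Gamma\models^\alpha_{\mathfrak B,2}A$, then $\Gamma\models^s_{\mathfrak B,2}A$. -/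

import Mathlib

namespace PTS

/-! ### Language and atomic bases -/

/-- Atomic formulas: infinitely many propositional variables and the constant `⊥`. -/
inductive Atom : Type
  | var (i : ℕ)
  | bot

/-- Propositional formulas. -/
inductive Formula : Type
  | atom (a : Atom)
  | and (A B : Formula)
  | or (A B : Formula)
  | imp (A B : Formula)

/-- The formula is an atom. -/
def Formula.IsAtomic (A : Formula) : Prop := ∃ a, A = .atom a

/-- An atomic rule with premises `prem 0, …, prem (n - 1)` and conclusion `concl`; its application
may discharge, above the premise `prem i`, the atomic rules `dis i l` for `l < m i`. -/
inductive AtomicRule : Type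
  | mk (n : ℕ) (prem : Fin n → Atom) (m : Fin n → ℕ)
      (dis : (i : Fin n) → Fin (m i) → AtomicRule) (concl : Atom)

namespace AtomicRule

/-- An atom regarded as a rule without premises. -/
def fact (a : Atom) : AtomicRule := .mk 0 Fin.elim0 Fin.elim0 (fun i => i.elim0) a

/-- Atomic explosion: from `⊥` infer `a`. -/
def atExp (a : Atom) : AtomicRule := .mk 1 (fun _ => .bot) (fun _ => 0) (fun _ l => l.elim0) a

/-- The level of a rule: `0` without premises, `1` with premises but without discharge, and
`k + 2` if `k` is the maximal level of the rules that it discharges. -/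
def level : AtomicRule → ℕ
  | .mk _ _ m dis _ => Finset.univ.sup fun i =>
      if m i = 0 then 1 else (Finset.univ.sup fun l => (dis i l).level) + 2

end AtomicRule

/-- `𝔹 n`: the atomic bases of level at most `n`. A base contains all instances of atomic explosion,
which are disregarded when the level is counted; it may be infinite. -/
def Bases (n : ℕ) : Set (Set AtomicRule) :=
  {𝔅 | (∀ a, AtomicRule.atExp a ∈ 𝔅) ∧ ∀ R ∈ 𝔅, (∃ a, R = AtomicRule.atExp a) ∨ R.level ≤ n}

/-- `ℭ ⊇ₙ 𝔅`: `ℭ` is an extension of `𝔅` and has level at most `n`. -/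
def Extends (n : ℕ) (ℭ 𝔅 : Set AtomicRule) : Prop := 𝔅 ⊆ ℭ ∧ ℭ ∈ Bases n

/-! ### Trees with discharge functions -/

/-- Finite trees labelled by formulas. Top-nodes are assumptions (`asm`) or atoms used as level-0
rules (`ax`). The discharge functions are coded by the field `d`: it is `none` outside of their
domains, and `some k` if the value is the `k`-th node below, where `k = 0` is the parent. On `asm`
this is the function `f` (discharge of assumptions), on `ax` the function `h` (discharge of level-0
rules), and on `node` the function `g` (discharge of the edges from the node to its children, i.e.
of the rule applied there). -/
inductive Tree : Type
  | asm (A : Formula) (d : Option ℕ)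
  | ax (a : Atom) (d : Option ℕ)
  | node (A : Formula) (d : Option ℕ) (n : ℕ) (c : Fin n → Tree)

namespace Tree

/-- The label of the root, that is, the conclusion. -/
def label : Tree → Formula
  | .asm A _ => A
  | .ax a _ => .atom a
  | .node A _ _ _ => A

/-- The value of the discharge function at the root. -/
def disch : Tree → Option ℕ
  | .asm _ d => d
  | .ax _ d => d
  | .node _ d _ _ => d

/-- The root is an assumption. -/
def IsAsm (T : Tree) : Prop := ∃ A d, T = .asm A d

/-- `T.Occ j u`: the subtree `u` occurs in `T` at depth `j`. -/
inductive Occ : Tree → ℕ → Tree → Prop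
  | root (T : Tree) : Occ T 0 T
  | child {A : Formula} {d : Option ℕ} {n : ℕ} {c : Fin n → Tree} (i : Fin n) {j : ℕ} {u : Tree} :
      Occ (c i) j u → Occ (.node A d n c) (j + 1) u

/-- `u` occurs in the tree `T` and is discharged at the parent of the root of `T`. -/
def BoundBelow (T u : Tree) : Prop := ∃ j, T.Occ j u ∧ u.disch = some j

/-- The conditions on a node: an inner node has children; if an atomic rule is discharged at it, or if
the rule applied at it is discharged elsewhere, then it and its children are labelled by atoms
and no assumption is discharged at it. -/
def NodeOK : Tree → Prop
  | .asm _ _ => True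
  | .ax _ _ => True
  | .node A d n c => n ≠ 0 ∧
      ((d ≠ none ∨ ∃ i u, (c i).BoundBelow u ∧ ¬ u.IsAsm) →
        A.IsAtomic ∧ (∀ i, (c i).label.IsAtomic) ∧ ∀ i u, (c i).BoundBelow u → ¬ u.IsAsm)

/-- Argument structures: all discharges take place at a node of the tree, and every node satisfies the
conditions above. -/
def IsArg (T : Tree) : Prop :=
  ∀ j u, T.Occ j u → (∀ k, u.disch = some k → k < j) ∧ u.NodeOK

/-- The set of undischarged assumptions of an argument structure. -/
def openAsm (T : Tree) : Set Formula := {A | ∃ j, T.Occ j (.asm A none)}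

/-- All assumptions are discharged. -/
def Closed (T : Tree) : Prop := T.openAsm = ∅

/-- Delete the discharges which point further down than `k` nodes below the root. -/
def prune (k : ℕ) : Tree → Tree
  | .asm A d => .asm A (d.filter (· < k))
  | .ax a d => .ax a (d.filter (· < k))
  | .node A d n c => .node A (d.filter (· < k)) n fun i => (c i).prune (k + 1)

/-- The sub-structure given by a subtree: what is discharged below its root is undischarged in it. -/
def sub (T : Tree) : Tree := T.prune 0

/-- Replace each undischarged assumption `A` by `σ A`. -/
def subst (σ : Formula → Tree) : Tree → Tree
  | .asm A none => σ A
  | .asm A (some k) => .asm A (some k)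
  | .ax a d => .ax a d
  | .node A d n c => .node A d n fun i => (c i).subst σ

end Tree

/-- `σ` assigns to each formula an argument structure (closed or not) with that conclusion. -/
def IsSubst (σ : Formula → Tree) : Prop := ∀ A, (σ A).IsArg ∧ (σ A).label = A

/-! ### Derivations in an atomic base -/

/-- `R` may be applied with discharge value `d`: undischarged applications need `R ∈ 𝔅`, discharged
ones need that `R` is among the rules that may be discharged at the indicated node. -/
def Available (𝔅 : Set AtomicRule) (ctx : List (Set AtomicRule)) (R : AtomicRule) :
    Option ℕ → Prop
  | none => R ∈ 𝔅
  | some k => ∃ S, ctx[k]? = some S ∧ R ∈ S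

/-- `IsDer 𝔅 ctx T a`: the tree `T` is an atomic derivation of `a` in which every undischarged rule
belongs to `𝔅`, inside of a derivation whose rule applications below `T`, from the nearest one
on, allow to discharge the sets of rules in the list `ctx`. -/
inductive IsDer (𝔅 : Set AtomicRule) : List (Set AtomicRule) → Tree → Atom → Prop
  | fact {ctx : List (Set AtomicRule)} {a : Atom} {d : Option ℕ} :
      Available 𝔅 ctx (AtomicRule.fact a) d → IsDer 𝔅 ctx (.ax a d) a
  | app {ctx : List (Set AtomicRule)} {a : Atom} {d : Option ℕ} {n : ℕ} {c : Fin n → Tree}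
      {prem : Fin n → Atom} {m : Fin n → ℕ} {dis : (i : Fin n) → Fin (m i) → AtomicRule} :
      n ≠ 0 → Available 𝔅 ctx (.mk n prem m dis a) d →
      (∀ i, IsDer 𝔅 (Set.range (dis i) :: ctx) (c i) (prem i)) →
      IsDer 𝔅 ctx (.node (.atom a) d n c) a

/-- `⊢_𝔅 a`: there is a derivation of `a` from `∅` in `𝔅`. -/
def Derivable (𝔅 : Set AtomicRule) (a : Atom) : Prop := ∃ T, IsDer 𝔅 [] T a

/-! ### Sandqvist's base semantics -/

/-- `⊨ˢ_{𝔅,n} A`, the case without assumptions, for `𝔅 ∈ 𝔹 n`. -/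
def SHolds (n : ℕ) : Formula → Set AtomicRule → Prop
  | .atom a, 𝔅 => Derivable 𝔅 a
  | .and A B, 𝔅 => SHolds n A 𝔅 ∧ SHolds n B 𝔅
  | .or A B, 𝔅 => ∀ ℭ, Extends n ℭ 𝔅 → ∀ a : Atom,
      (∀ 𝔇, Extends n 𝔇 ℭ → SHolds n A 𝔇 → Derivable 𝔇 a) →
      (∀ 𝔇, Extends n 𝔇 ℭ → SHolds n B 𝔇 → Derivable 𝔇 a) → Derivable ℭ a
  | .imp A B, 𝔅 => ∀ ℭ, Extends n ℭ 𝔅 → SHolds n A ℭ → SHolds n B ℭ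

/-- `Γ ⊨ˢ_{𝔅,n} A`: consequence on `𝔅` in Sandqvist's sense. -/
def SConseq (n : ℕ) (𝔅 : Set AtomicRule) (Γ : Finset Formula) (A : Formula) : Prop :=
  𝔅 ∈ Bases n ∧ (Γ = ∅ → SHolds n A 𝔅) ∧
    (Γ ≠ ∅ → ∀ ℭ, Extends n ℭ 𝔅 → (∀ B ∈ Γ, SHolds n B ℭ) → SHolds n A ℭ)

/-! ### Rules, reductions, reducibility -/

/-- The argument structures associated to inferences, that is, those with an inner node as root; the
premises of the inference are the immediate sub-structures, and its additional discharges are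
those at the root. -/
def IsInference (D : Tree) : Prop := D.IsArg ∧ ∃ A n c, D = .node A none n c

/-- `φ` is a reduction for the rule given by the set `ℛ` of its instances: a partial map on `ℛ` which
preserves the conclusion, introduces no assumptions and commutes with substitutions. -/
structure IsReductionFor (ℛ : Set Tree) (φ : Tree → Option Tree) : Prop where
  dom : ∀ D E, φ D = some E → D ∈ ℛ
  isArg : ∀ D E, φ D = some E → E.IsArg
  conclusion : ∀ D E, φ D = some E → E.label = D.label
  assumptions : ∀ D E, φ D = some E → E.openAsm ⊆ D.openAsm
  instances : ∀ D E, φ D = some E → ∀ σ, IsSubst σ → φ (D.subst σ) = some (E.subst σ)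

/-- Reductions: reductions for some rule, a rule being any set of inferences. -/
def Reduction : Type :=
  {φ : Tree → Option Tree // ∃ ℛ : Set Tree, (∀ D ∈ ℛ, IsInference D) ∧ IsReductionFor ℛ φ}

/-- The root of the tree is an application of the rule; what is discharged there is among the rules
which the rule may discharge above the premise in question. -/
def AtomicRule.AppliedAt : AtomicRule → Tree → Prop
  | .mk n prem _ dis a, T => (n = 0 ∧ ∃ d, T = .ax a d) ∨
      (n ≠ 0 ∧ ∃ d c, T = .node (.atom a) d n c ∧ ∀ i, (c i).label = .atom (prem i) ∧
        ∀ u, (c i).BoundBelow u → ∃ l, (dis i l).AppliedAt u)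

/-- What is assumed at a node: a formula, or an atomic rule. The node alone fixes the latter up to rules
discharged vacuously, so that the set of the rules which fit the node is taken. -/
inductive Item : Type
  | formula (A : Formula)
  | rule (X : Set AtomicRule)

/-- What is assumed at the root of a tree. -/
def Tree.item : Tree → Item
  | .asm A _ => .formula A
  | .ax a d => .rule {R | R.AppliedAt (.ax a d)}
  | .node A d n c => .rule {R | R.AppliedAt (.node A d n c)}

/-- `x` is assumed in the subtree `T` and not discharged in it; `s = none` if it is not discharged at
all, and `s = some k` if it is discharged at the `k`-th node below the root of `T`, where `k = 0`
is the parent. -/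
def Tree.Free (T : Tree) (x : Item) (s : Option ℕ) : Prop :=
  ∃ j u, T.Occ j u ∧ u.item = x ∧
    ((u.disch = none ∧ s = none) ∨ ∃ k, u.disch = some (j + k) ∧ s = some k)

/-- The discharges by nodes below `T'` are those by nodes below `T`: whatever is assumed in both is
treated in `T'` as at one of its occurrences in `T`, and the rest is undischarged. -/
def Tree.Inherits (T T' : Tree) : Prop :=
  ∀ x s, T'.Free x s → T.Free x s ∨ (s = none ∧ ∀ s', ¬ T.Free x s')

/-- `D.Replace T D' T'`: the tree `D'` is `D` with an occurrence of the subtree `T` replaced by `T'`. -/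
inductive Tree.Replace : Tree → Tree → Tree → Tree → Prop
  | root (T T' : Tree) : Replace T T T' T'
  | child {A : Formula} {d : Option ℕ} {n : ℕ} {c : Fin n → Tree} (i : Fin n) {e T T' : Tree} :
      Replace (c i) T e T' → Replace (.node A d n c) T (.node A d n (Function.update c i e)) T'

/-- `D` immediately reduces to `D'` relative to `𝔍`: a sub-structure of `D` is replaced by its image
under a reduction in `𝔍`, the discharges from outside being taken over. -/
def Step (𝔍 : Set Reduction) (D D' : Tree) : Prop :=
  D'.IsArg ∧ ∃ T T', D.Replace T D' T' ∧ (∃ φ ∈ 𝔍, φ.1 T.sub = some T'.sub) ∧ T.Inherits T'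

/-- `D ≤_𝔍 D'`. -/
def Reduces (𝔍 : Set Reduction) : Tree → Tree → Prop := Relation.ReflTransGen (Step 𝔍)

/-! ### Validity of arguments, and reducibility semantics -/

/-- The last step of the tree is an instance of an introduction rule. -/
inductive Canonical : Tree → Prop
  | and {A B : Formula} {c : Fin 2 → Tree} : (c 0).label = A → (c 1).label = B →
      (∀ i u, ¬ (c i).BoundBelow u) → Canonical (.node (.and A B) none 2 c)
  | orLeft {A B : Formula} {c : Fin 1 → Tree} : (c 0).label = A →
      (∀ u, ¬ (c 0).BoundBelow u) → Canonical (.node (.or A B) none 1 c)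
  | orRight {A B : Formula} {c : Fin 1 → Tree} : (c 0).label = B →
      (∀ u, ¬ (c 0).BoundBelow u) → Canonical (.node (.or A B) none 1 c)
  | imp {A B : Formula} {c : Fin 1 → Tree} : (c 0).label = B →
      (∀ u, (c 0).BoundBelow u → ∃ d, u = .asm A d) → Canonical (.node (.imp A B) none 1 c)

/-- Validity on `𝔅 ∈ 𝔹 n` of `⟨D, 𝔍⟩` for a closed argument structure `D` whose conclusion is the given
formula, by recursion on the latter. In the clause for `A → B` the validity of the immediate
sub-structure is spelled out: it is closed, or `A` is its only assumption. -/
def ClosedValid (n : ℕ) : Formula → Set AtomicRule → Set Reduction → Tree → Prop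
  | .atom a, 𝔅, 𝔍, D => ∃ D', Reduces 𝔍 D D' ∧ IsDer 𝔅 [] D' a
  | .and A B, 𝔅, 𝔍, D => ∃ c : Fin 2 → Tree,
      Reduces 𝔍 D (.node (.and A B) none 2 c) ∧ Canonical (.node (.and A B) none 2 c) ∧
      ClosedValid n A 𝔅 𝔍 (c 0).sub ∧ ClosedValid n B 𝔅 𝔍 (c 1).sub
  | .or A B, 𝔅, 𝔍, D => ∃ c : Fin 1 → Tree,
      Reduces 𝔍 D (.node (.or A B) none 1 c) ∧ Canonical (.node (.or A B) none 1 c) ∧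
      (((c 0).label = A ∧ ClosedValid n A 𝔅 𝔍 (c 0).sub) ∨
        ((c 0).label = B ∧ ClosedValid n B 𝔅 𝔍 (c 0).sub))
  | .imp A B, 𝔅, 𝔍, D => ∃ c : Fin 1 → Tree,
      Reduces 𝔍 D (.node (.imp A B) none 1 c) ∧ Canonical (.node (.imp A B) none 1 c) ∧
      ((c 0).sub.Closed → ClosedValid n B 𝔅 𝔍 (c 0).sub) ∧
      (¬ (c 0).sub.Closed → ∀ σ, IsSubst σ → ∀ 𝔍', 𝔍 ⊆ 𝔍' → ∀ ℭ, Extends n ℭ 𝔅 →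
        (σ A).Closed → ClosedValid n A ℭ 𝔍' (σ A) →
          ClosedValid n B ℭ 𝔍' ((c 0).sub.subst σ))

/-- `⟨D, 𝔍⟩` is `n`-valid on `𝔅`. -/
def Valid (n : ℕ) (𝔅 : Set AtomicRule) (𝔍 : Set Reduction) (D : Tree) : Prop :=
  𝔅 ∈ Bases n ∧ (D.Closed → ClosedValid n D.label 𝔅 𝔍 D) ∧
  (¬ D.Closed → ∀ σ, IsSubst σ → ∀ 𝔍', 𝔍 ⊆ 𝔍' → ∀ ℭ, Extends n ℭ 𝔅 →
    (∀ A ∈ D.openAsm, (σ A).Closed ∧ ClosedValid n A ℭ 𝔍' (σ A)) →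
      ClosedValid n D.label ℭ 𝔍' (D.subst σ))

/-- `Γ ⊨ᵅ_{𝔅,n} A`: there is an argument from `Γ` to `A` which is `n`-valid on `𝔅`. -/
def AConseq (n : ℕ) (𝔅 : Set AtomicRule) (Γ : Finset Formula) (A : Formula) : Prop :=
  ∃ (D : Tree) (𝔍 : Set Reduction),
    D.IsArg ∧ D.openAsm = (Γ : Set Formula) ∧ D.label = A ∧ Valid n 𝔅 𝔍 D

end PTS

/-! The relations part over disjunction. A closed valid argument for `a ∨ b` reduces to canonical
form, so `a` or `b` is derivable (`ClosedValid.or_derivable`). Sandqvist's clause asks only for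
elimination into atoms, and the level-2 rules `orElim r a b e`, one for each atom `e`, supply this
as soon as `r` is derivable (`sHolds_or_of_orElim`). Against the first inclusion, take these rules
together with the axiom `r`: `a ∨ b` holds for Sandqvist, while neither `a` nor `b` is derivable.
Against the second, take the rules `peirce r a` and `peirce r b`. If `r → a ∨ b` has a closed valid
argument on an extension, then `a` or `b` is derivable there from `r`
(`ClosedValid.imp_or_derivable`), and the corresponding rule yields `r`; since arbitrary reductions
are admitted, this makes `r` a consequence of `r → a ∨ b`. For Sandqvist it is not: adding the
`orElim` rules makes `r → a ∨ b` hold without making `r` derivable. Underivability comes from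
soundness (`IsDer.mem_world`) in the model `fork`: its two leaves serve the first claim, its root
the second. -/

namespace PTS

/-! ### Kripke models of atomic rules -/

/-- A rule holds at the world `w` of the Kripke model whose worlds are the members of `𝒲`, each being
the set of the atoms true at it, ordered by inclusion. -/
def AtomicRule.Forced (𝒲 : Set (Set Atom)) : AtomicRule → Set Atom → Prop
  | .mk _ prem _ dis a, w => ∀ w' ∈ 𝒲, w ⊆ w' →
      (∀ i, ∀ w'' ∈ 𝒲, w' ⊆ w'' → (∀ l, (dis i l).Forced 𝒲 w'') → prem i ∈ w'') → a ∈ w'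

theorem AtomicRule.Forced.mono {𝒲 : Set (Set Atom)} {R : AtomicRule} {w w' : Set Atom}
    (h : R.Forced 𝒲 w) (hw : w ⊆ w') : R.Forced 𝒲 w' := by
  cases R
  simp only [AtomicRule.Forced] at h ⊢
  exact fun v hv hwv => h v hv (hw.trans hwv)

theorem AtomicRule.forced_fact {𝒲 : Set (Set Atom)} {a : Atom} {w : Set Atom} (h : a ∈ w) :
    (AtomicRule.fact a).Forced 𝒲 w := by
  simp only [AtomicRule.fact, AtomicRule.Forced]
  exact fun v _ hwv _ => hwv h

theorem AtomicRule.forced_atExp {𝒲 : Set (Set Atom)} (h𝒲 : ∀ w ∈ 𝒲, Atom.bot ∉ w) (a : Atom)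
    (w : Set Atom) : (AtomicRule.atExp a).Forced 𝒲 w := by
  simp only [AtomicRule.atExp, AtomicRule.Forced]
  exact fun v hv _ h => absurd (h 0 v hv subset_rfl fun l => l.elim0) (h𝒲 v hv)

/-- Soundness of atomic derivations for Kripke models. -/
theorem IsDer.mem_world {𝒲 : Set (Set Atom)} {𝔅 : Set AtomicRule} {ctx : List (Set AtomicRule)}
    {T : Tree} {a : Atom} (h : IsDer 𝔅 ctx T a) : ∀ w ∈ 𝒲, (∀ R ∈ 𝔅, R.Forced 𝒲 w) →
      (∀ S ∈ ctx, ∀ R ∈ S, R.Forced 𝒲 w) → a ∈ w := by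
  have avail : ∀ {ctx : List (Set AtomicRule)} {R : AtomicRule} {d : Option ℕ} {w : Set Atom},
      Available 𝔅 ctx R d → (∀ R ∈ 𝔅, R.Forced 𝒲 w) →
      (∀ S ∈ ctx, ∀ R ∈ S, R.Forced 𝒲 w) → R.Forced 𝒲 w := by
    intro ctx R d w hR h𝔅 hctx
    cases d with
    | none => exact h𝔅 R hR
    | some k =>
      obtain ⟨S, hS, hRS⟩ := hR
      exact hctx S (List.mem_of_getElem? hS) R hRS
  induction h with
  | fact hR =>
    intro w hw h𝔅 hctx
    have := avail hR h𝔅 hctx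
    simp only [AtomicRule.fact, AtomicRule.Forced] at this
    exact this w hw subset_rfl fun i => i.elim0
  | app _ hR _ ih =>
    intro w hw h𝔅 hctx
    have := avail hR h𝔅 hctx
    simp only [AtomicRule.Forced] at this
    -- A premise is evaluated at a later world that forces the rules discharged above it; all other
    -- rules persist to that world.
    refine this w hw subset_rfl fun i v hv hwv hdis => ih i v hv
      (fun R hR => (h𝔅 R hR).mono hwv) fun S hS R hRS => ?_
    rcases List.mem_cons.1 hS with rfl | hS
    · obtain ⟨l, rfl⟩ := hRS
      exact hdis l
    · exact (hctx S hS R hRS).mono hwv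

/-! ### Atomic derivations -/

/-- The rules of a base can be discharged: if they are in `𝔅` or in `S`, it suffices that `S` may be
discharged below the derivation. -/
theorem IsDer.discharge {𝔅 𝔅' S : Set AtomicRule} (hsub : 𝔅' ⊆ 𝔅 ∪ S)
    {ctx : List (Set AtomicRule)} {T : Tree} {a : Atom} (h : IsDer 𝔅' ctx T a) :
    ∃ T', IsDer 𝔅 (ctx ++ [S]) T' a := by
  have avail : ∀ {ctx : List (Set AtomicRule)} {R : AtomicRule} {d : Option ℕ},
      Available 𝔅' ctx R d → ∃ d', Available 𝔅 (ctx ++ [S]) R d' := by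
    intro ctx R d hR
    cases d with
    | none =>
      rcases hsub hR with h | h
      · exact ⟨none, h⟩
      -- `S` is appended at the bottom end of the context, so its index is `ctx.length` and the old
      -- discharge values stay correct.
      · exact ⟨some ctx.length, S, by simp, h⟩
    | some k =>
      obtain ⟨U, hU, hRU⟩ := hR
      refine ⟨some k, U, ?_, hRU⟩
      rw [List.getElem?_append_left (List.getElem?_eq_some_iff.1 hU).1, hU]
  induction h with
  | fact hR =>
    obtain ⟨d', hd'⟩ := avail hR
    exact ⟨_, .fact hd'⟩
  | app hn hR _ ih =>
    obtain ⟨d', hd'⟩ := avail hR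
    choose c hc using ih
    exact ⟨_, .app hn hd' hc⟩

theorem IsDer.label_eq {𝔅 : Set AtomicRule} {ctx : List (Set AtomicRule)} {T : Tree} {a : Atom}
    (h : IsDer 𝔅 ctx T a) : T.label = .atom a := by
  cases h <;> rfl

theorem IsDer.not_isAsm {𝔅 : Set AtomicRule} {ctx : List (Set AtomicRule)} {T : Tree} {a : Atom}
    (h : IsDer 𝔅 ctx T a) : ¬ T.IsAsm := by
  rintro ⟨A, d, rfl⟩
  cases h

/-- Each step upwards adds one entry to the context; the length count is what bounds discharge
values by the depth in `IsDer.isArg`. -/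
theorem IsDer.occ {𝔅 : Set AtomicRule} {ctx : List (Set AtomicRule)} {T u : Tree} {a : Atom} {j : ℕ}
    (h : IsDer 𝔅 ctx T a) (hu : T.Occ j u) :
    ∃ ctx' b, ctx'.length = j + ctx.length ∧ IsDer 𝔅 ctx' u b := by
  induction hu generalizing ctx a with
  | root T => exact ⟨ctx, a, by simp, h⟩
  | child i _ ih =>
    cases h with
    | app _ _ hc =>
      obtain ⟨ctx', b, hlen, hb⟩ := ih (hc i)
      exact ⟨ctx', b, by simp only [hlen, List.length_cons]; omega, hb⟩

theorem IsDer.disch_lt {𝔅 : Set AtomicRule} {ctx : List (Set AtomicRule)} {T : Tree} {a : Atom}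
    (h : IsDer 𝔅 ctx T a) {k : ℕ} (hk : T.disch = some k) : k < ctx.length := by
  have avail : ∀ {R : AtomicRule}, Available 𝔅 ctx R (some k) → k < ctx.length := by
    rintro R ⟨S, hS, -⟩
    exact (List.getElem?_eq_some_iff.1 hS).1
  cases h with
  | fact hR => cases hk; exact avail hR
  | app _ hR _ => cases hk; exact avail hR

theorem IsDer.nodeOK {𝔅 : Set AtomicRule} {ctx : List (Set AtomicRule)} {T : Tree} {a : Atom}
    (h : IsDer 𝔅 ctx T a) : T.NodeOK := by
  cases h with
  | fact => trivial
  | app hn _ hc =>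
    refine ⟨hn, fun _ => ⟨⟨a, rfl⟩, fun i => ⟨_, (hc i).label_eq⟩, ?_⟩⟩
    rintro i u ⟨j, hu, -⟩
    obtain ⟨_, _, -, hb⟩ := (hc i).occ hu
    exact hb.not_isAsm

theorem IsDer.isArg {𝔅 : Set AtomicRule} {T : Tree} {a : Atom} (h : IsDer 𝔅 [] T a) : T.IsArg := by
  intro j u hu
  obtain ⟨ctx', b, hlen, hb⟩ := h.occ hu
  refine ⟨fun k hk => ?_, hb.nodeOK⟩
  simpa [hlen] using hb.disch_lt hk

theorem IsDer.closed {𝔅 : Set AtomicRule} {ctx : List (Set AtomicRule)} {T : Tree} {a : Atom}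
    (h : IsDer 𝔅 ctx T a) : T.Closed := by
  refine Set.eq_empty_of_forall_notMem ?_
  rintro A ⟨j, hu⟩
  obtain ⟨_, _, -, hb⟩ := h.occ hu
  exact hb.not_isAsm ⟨A, none, rfl⟩

theorem Extends.insert_fact {n : ℕ} {𝔅 : Set AtomicRule} (h : 𝔅 ∈ Bases n) (a : Atom) :
    Extends n (insert (AtomicRule.fact a) 𝔅) 𝔅 := by
  refine ⟨Set.subset_insert _ _, fun b => Set.mem_insert_of_mem _ (h.1 b), ?_⟩
  rintro R (rfl | hR)
  · exact .inr (by simp [AtomicRule.fact, AtomicRule.level])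
  · exact h.2 R hR

/-! ### Argument structures -/

theorem Tree.prune_eq_self {T : Tree} {k : ℕ}
    (h : ∀ j u, T.Occ j u → ∀ l, u.disch = some l → l < j + k) : T.prune k = T := by
  have filter : ∀ {d : Option ℕ}, (∀ l, d = some l → l < k) → d.filter (· < k) = d := by
    intro d hd
    cases d with
    | none => rfl
    | some l => simpa [Option.filter] using hd l rfl
  induction T generalizing k with
  | asm A d =>
    rw [Tree.prune, filter fun l hl => by simpa using h 0 _ (.root _) l hl]
  | ax a d =>
    rw [Tree.prune, filter fun l hl => by simpa using h 0 _ (.root _) l hl]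
  | node A d n c ih =>
    rw [Tree.prune, filter fun l hl => by simpa using h 0 _ (.root _) l hl]
    congr 1
    funext i
    refine ih i (fun j u hu l hl => ?_) (fun {d} hd => ?_)
    · have := h (j + 1) u (.child i hu) l hl
      omega
    -- The local fact `filter` depends on `k`, so the induction hypothesis asks for it again at `k +
    -- 1`.
    · cases d with
      | none => rfl
      | some l => simpa [Option.filter] using hd l rfl

theorem Tree.IsArg.sub_eq {T : Tree} (h : T.IsArg) : T.sub = T :=
  Tree.prune_eq_self fun j u hu l hl => by simpa using (h j u hu).1 l hl

theorem Tree.IsArg.not_boundBelow {T : Tree} (h : T.IsArg) (u : Tree) : ¬ T.BoundBelow u := by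
  rintro ⟨j, hu, hj⟩
  exact lt_irrefl j ((h j u hu).1 j hj)

theorem Tree.Closed.subst_eq {T : Tree} (h : T.Closed) (σ : Formula → Tree) : T.subst σ = T := by
  induction T with
  | asm A d =>
    cases d with
    | none => exact absurd (show A ∈ (∅ : Set Formula) from h ▸ ⟨0, .root _⟩) (Set.notMem_empty A)
    | some k => rfl
  | ax a d => rfl
  | node A d n c ih =>
    rw [Tree.subst]
    congr 1
    funext i
    refine ih i (Set.eq_empty_of_forall_notMem ?_)
    rintro B ⟨j, hj⟩
    exact absurd (show B ∈ (∅ : Set Formula) from h ▸ ⟨j + 1, .child i hj⟩) (Set.notMem_empty B)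

theorem Tree.IsArg.node_one {T : Tree} (h : T.IsArg) (A : Formula) :
    (Tree.node A none 1 fun _ => T).IsArg := by
  intro j u hu
  cases hu with
  | root =>
    refine ⟨fun k hk => (Option.some_ne_none k hk.symm).elim, one_ne_zero, ?_⟩
    rintro (h' | ⟨i, u, hu, -⟩)
    · exact absurd rfl h'
    · exact absurd hu (h.not_boundBelow u)
  | child i hu =>
    obtain ⟨h₁, h₂⟩ := h _ _ hu
    exact ⟨fun k hk => Nat.lt_succ_of_lt (h₁ k hk), h₂⟩

theorem Tree.openAsm_node_one (A : Formula) (T : Tree) :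
    (Tree.node A none 1 fun _ => T).openAsm = T.openAsm := by
  ext B
  constructor
  · rintro ⟨j, hj⟩
    cases hj with
    | child i hj => exact ⟨_, hj⟩
  · rintro ⟨j, hj⟩
    exact ⟨j + 1, .child 0 hj⟩

theorem Tree.isArg_asm (A : Formula) : (Tree.asm A none).IsArg := by
  intro j u hu
  cases hu
  exact ⟨fun k hk => (Option.some_ne_none k hk.symm).elim, trivial⟩

theorem Tree.openAsm_asm (A : Formula) : (Tree.asm A none).openAsm = {A} := by
  ext B
  constructor
  · rintro ⟨j, hj⟩
    cases hj
    rfl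
  · rintro rfl
    exact ⟨0, .root _⟩

theorem Tree.IsArg.free_eq_none {T : Tree} (h : T.IsArg) {x : Item} {s : Option ℕ}
    (hx : T.Free x s) : s = none := by
  obtain ⟨j, u, hu, -, ⟨-, hs⟩ | ⟨k, hk, -⟩⟩ := hx
  · exact hs
  · have := (h j u hu).1 _ hk
    omega

/-- In a complete argument structure no discharge points below the root, so there is nothing to take
over. -/
theorem Tree.IsArg.inherits {T T' : Tree} (h : T.IsArg) (h' : T'.IsArg) : T.Inherits T' := by
  intro x s hx
  obtain rfl := h'.free_eq_none hx
  by_cases hT : T.Free x none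
  · exact .inl hT
  · exact .inr ⟨rfl, fun s' hs' => hT (h.free_eq_none hs' ▸ hs')⟩

/-! ### Reductions of closed inferences -/

open Classical in
/-- The reduction defined on a single closed inference. -/
noncomputable def Reduction.single (D E : Tree) (hD : IsInference D) (hDc : D.Closed)
    (hE : E.IsArg) (hEc : E.Closed) (hl : E.label = D.label) : Reduction :=
  ⟨fun T => if T = D then some E else none, {D}, by rintro _ rfl; exact hD,
    { dom := fun T F h => by
        by_contra hT
        exact absurd h (by simp [show T ≠ D from hT])
      isArg := fun T F h => by split_ifs at h; cases h; exact hE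
      conclusion := fun T F h => by
        split_ifs at h with hT
        cases h
        rw [hT, hl]
      assumptions := fun T F h => by
        split_ifs at h
        cases h
        exact hEc.le.trans (Set.empty_subset _)
      -- Substitution fixes both `D` and `E`, as they are closed.
      instances := fun T F h σ _ => by
        split_ifs at h with hT
        cases h
        rw [hT, hDc.subst_eq, hEc.subst_eq, if_pos rfl] }⟩

/-- A single reduction at the root suffices. With all reductions present, the validity of a closed
inference of an atom thus comes down to the derivability of that atom. -/
theorem reduces_of_closed {𝔍 : Set Reduction} (h𝔍 : Set.univ ⊆ 𝔍) {D E : Tree}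
    (hD : IsInference D) (hDc : D.Closed) (hE : E.IsArg) (hEc : E.Closed)
    (hl : E.label = D.label) : Reduces 𝔍 D E := by
  refine .single ⟨hE, D, E, .root D E,
    ⟨Reduction.single D E hD hDc hE hEc hl, h𝔍 (Set.mem_univ _), ?_⟩, hD.1.inherits hE⟩
  rw [hD.1.sub_eq, hE.sub_eq]
  exact if_pos rfl

/-- The disjunction property of the reducibility semantics, for atoms. -/
theorem ClosedValid.or_derivable {n : ℕ} {a b : Atom} {𝔅 : Set AtomicRule} {𝔍 : Set Reduction}
    {D : Tree} (h : ClosedValid n (.or (.atom a) (.atom b)) 𝔅 𝔍 D) :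
    Derivable 𝔅 a ∨ Derivable 𝔅 b := by
  obtain ⟨c, -, -, ⟨-, T, -, hT⟩ | ⟨-, T, -, hT⟩⟩ := h
  · exact .inl ⟨T, hT⟩
  · exact .inr ⟨T, hT⟩

/-- The substitution of axioms for atomic assumptions. -/
def axSubst : Formula → Tree
  | .atom a => .ax a none
  -- Only the atomic case matters; this value merely has the right conclusion.
  | A => .asm A none

theorem isDer_ax {𝔅 : Set AtomicRule} {a : Atom} (h : AtomicRule.fact a ∈ 𝔅) :
    IsDer 𝔅 [] (.ax a none) a := .fact h

theorem isSubst_axSubst : IsSubst axSubst := by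
  intro A
  cases A with
  | atom a => exact ⟨(isDer_ax (Set.mem_singleton (AtomicRule.fact a))).isArg, rfl⟩
  | and A B => exact ⟨Tree.isArg_asm _, rfl⟩
  | or A B => exact ⟨Tree.isArg_asm _, rfl⟩
  | imp A B => exact ⟨Tree.isArg_asm _, rfl⟩

/-- An open premise of the canonical form is tested on the extension of `𝔅` by the axiom `r`, with
that axiom as the argument for `r`; a closed premise already decides the disjunction in `𝔅`. -/
theorem ClosedValid.imp_or_derivable {n : ℕ} {r a b : Atom} {𝔅 : Set AtomicRule}
    {𝔍 : Set Reduction} {D : Tree} (h𝔅 : 𝔅 ∈ Bases n)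
    (h : ClosedValid n (.imp (.atom r) (.or (.atom a) (.atom b))) 𝔅 𝔍 D) :
    Derivable (insert (AtomicRule.fact r) 𝔅) a ∨ Derivable (insert (AtomicRule.fact r) 𝔅) b := by
  obtain ⟨c, -, -, hclosed, hopen⟩ := h
  by_cases hc : (c 0).sub.Closed
  · have mono : ∀ {e}, Derivable 𝔅 e → Derivable (insert (AtomicRule.fact r) 𝔅) e := by
      rintro e ⟨T, hT⟩
      suffices H : ∀ {ctx T e}, IsDer 𝔅 ctx T e →
          IsDer (insert (AtomicRule.fact r) 𝔅) ctx T e from ⟨T, H hT⟩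
      have avail : ∀ {ctx R d}, Available 𝔅 ctx R d →
          Available (insert (AtomicRule.fact r) 𝔅) ctx R d := by
        intro ctx R d hR
        cases d with
        | none => exact Set.mem_insert_of_mem _ hR
        | some k => exact hR
      intro ctx T e h
      induction h with
      | fact hR => exact .fact (avail hR)
      | app hn hR _ ih => exact .app hn (avail hR) ih
    exact (hclosed hc).or_derivable.imp mono mono
  · have hr := isDer_ax (Set.mem_insert (AtomicRule.fact r) 𝔅)
    exact (hopen hc axSubst isSubst_axSubst 𝔍 subset_rfl _ (Extends.insert_fact h𝔅 r) hr.closed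
      ⟨_, .refl, hr⟩).or_derivable

/-! ### The bases -/

/-- The rule that infers `e` from `r`, from `e` discharging `a`, and from `e` discharging `b`. -/
def orElim (r a b e : Atom) : AtomicRule :=
  .mk 3 ![r, e, e] ![0, 1, 1]
    -- At `i = 0` there is no index `l`, so the `else` branch concerns `i = 2` only.
    (fun i _ => if i = 1 then AtomicRule.fact a else AtomicRule.fact b) e

/-- The rule that infers `r` from `a` discharging `r`. -/
def peirce (r a : Atom) : AtomicRule :=
  .mk 1 (fun _ => a) (fun _ => 1) (fun _ _ => AtomicRule.fact r) r

theorem level_fact (a : Atom) : (AtomicRule.fact a).level = 0 := by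
  simp [AtomicRule.fact, AtomicRule.level]

theorem level_orElim (r a b e : Atom) : (orElim r a b e).level ≤ 2 := by
  simp only [orElim, AtomicRule.level]
  refine Finset.sup_le fun i _ => ?_
  split_ifs
  · omega
  all_goals exact Nat.add_le_add_right (Finset.sup_le fun l _ => (level_fact _).le) 2

theorem level_peirce (r a : Atom) : (peirce r a).level ≤ 2 := by
  simp only [peirce, AtomicRule.level]
  refine Finset.sup_le fun i _ => ?_
  rw [if_neg one_ne_zero]
  exact Nat.add_le_add_right (Finset.sup_le fun l _ => (level_fact r).le) 2

theorem range_atExp_union_mem_bases {n : ℕ} {X : Set AtomicRule} (hX : ∀ R ∈ X, R.level ≤ n) :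
    Set.range AtomicRule.atExp ∪ X ∈ Bases n := by
  refine ⟨fun a => .inl ⟨a, rfl⟩, ?_⟩
  rintro R (⟨a, rfl⟩ | hR)
  · exact .inl ⟨a, rfl⟩
  · exact .inr (hX R hR)

theorem derivable_of_peirce {𝔅 : Set AtomicRule} {r a : Atom} (h : peirce r a ∈ 𝔅)
    (ha : Derivable (insert (AtomicRule.fact r) 𝔅) a) : Derivable 𝔅 r := by
  obtain ⟨T, hT⟩ := ha
  obtain ⟨T', hT'⟩ := hT.discharge (𝔅 := 𝔅)
    (S := Set.range fun _ : Fin 1 => AtomicRule.fact r) (by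
      rintro R (rfl | hR)
      · exact .inr ⟨0, rfl⟩
      · exact .inl hR)
  exact ⟨_, IsDer.app (d := none) (c := fun _ => T') one_ne_zero h fun _ => hT'⟩

/-- The hypotheses on `e`, applied to the extensions by the axioms `a` and `b`, give derivations of
`e` in which these axioms can be discharged: the minor premises of `orElim r a b e`. -/
theorem sHolds_or_of_orElim {n : ℕ} {𝔅 : Set AtomicRule} {r a b : Atom}
    (h : Set.range (orElim r a b) ⊆ 𝔅) (hr : Derivable 𝔅 r) :
    SHolds n (.or (.atom a) (.atom b)) 𝔅 := by
  intro ℭ hℭ e ha hb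
  have discharge : ∀ (f : Atom) (S : Set AtomicRule), AtomicRule.fact f ∈ S →
      (∀ 𝔇, Extends n 𝔇 ℭ → SHolds n (.atom f) 𝔇 → Derivable 𝔇 e) →
      ∃ T, IsDer ℭ [S] T e := by
    intro f S hf hS
    obtain ⟨T, hT⟩ := hS _ (Extends.insert_fact hℭ.2 f) ⟨_, isDer_ax (Set.mem_insert _ _)⟩
    refine hT.discharge ?_
    rintro R (rfl | hR)
    · exact .inr hf
    · exact .inl hR
  obtain ⟨T, hT⟩ := hr
  have prem : ∀ i : Fin 3, ∃ T, IsDer ℭ [Set.range fun _ : Fin (![0, 1, 1] i) =>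
      if i = 1 then AtomicRule.fact a else AtomicRule.fact b] T (![r, e, e] i) := by
    intro i
    match i with
    | 0 => exact hT.discharge (hℭ.1.trans Set.subset_union_left)
    | 1 => exact discharge a _ ⟨(0 : Fin 1), rfl⟩ ha
    | 2 => exact discharge b _ ⟨(0 : Fin 1), rfl⟩ hb
  choose c hc using prem
  exact ⟨_, IsDer.app (d := none) (c := c) three_ne_zero (hℭ.1 (h ⟨e, rfl⟩)) hc⟩

/-! ### A Kripke model in which a disjunction is undecided at the root -/

/-- The model with a root where no atom is true and two leaves, where `r` is true together with one
of `a` and `b`. -/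
def fork (r a b : Atom) : Set (Set Atom) := {∅, {r, a}, {r, b}}

/-- The premise `r` fails at the root, and each leaf decides the disjunction, so one minor premise
already gives `e` there. -/
theorem forced_orElim_fork (r a b e : Atom) (w : Set Atom) :
    (orElim r a b e).Forced (fork r a b) w := by
  simp only [orElim, AtomicRule.Forced]
  rintro v hv - h
  have hr : r ∈ v := h 0 v hv subset_rfl fun l => l.elim0
  rcases hv with rfl | rfl | rfl
  · exact absurd hr (Set.notMem_empty r)
  · exact h 1 _ (.inr (.inl rfl)) subset_rfl fun _ =>
      AtomicRule.forced_fact (.inr rfl)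
  · exact h 2 _ (.inr (.inr rfl)) subset_rfl fun _ =>
      AtomicRule.forced_fact (.inr rfl)

theorem forced_peirce_fork {r a b f : Atom} (hra : r ≠ a) (hrb : r ≠ b) (hab : a ≠ b)
    (hf : f = a ∨ f = b) (w : Set Atom) : (peirce r f).Forced (fork r a b) w := by
  simp only [peirce, AtomicRule.Forced]
  rintro v hv - h
  rcases hv with rfl | rfl | rfl
  -- At the root, the premise would put `f` into both leaves, since both contain `r`; but `f` lies
  -- in just one of them.
  · exfalso
    have ha : f ∈ ({r, a} : Set Atom) := h 0 _ (.inr (.inl rfl)) (Set.empty_subset _) fun _ =>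
      AtomicRule.forced_fact (.inl rfl)
    have hb : f ∈ ({r, b} : Set Atom) := h 0 _ (.inr (.inr rfl)) (Set.empty_subset _) fun _ =>
      AtomicRule.forced_fact (.inl rfl)
    simp only [Set.mem_insert_iff, Set.mem_singleton_iff] at ha hb
    grind
  · exact .inl rfl
  · exact .inl rfl

theorem forced_atExp_fork {r a b : Atom} (hr : r ≠ .bot) (ha : a ≠ .bot) (hb : b ≠ .bot)
    (e : Atom) (w : Set Atom) : (AtomicRule.atExp e).Forced (fork r a b) w := by
  refine AtomicRule.forced_atExp ?_ e w
  rintro v (rfl | rfl | rfl)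
  · exact Set.notMem_empty _
  · simp [hr.symm, ha.symm]
  · simp [hr.symm, hb.symm]

/-! ### The two failures of inclusion -/

theorem exists_sConseq_not_aConseq : ∃ (A : Formula), ∃ 𝔅 ∈ Bases 2,
    SConseq 2 𝔅 ∅ A ∧ ¬ AConseq 2 𝔅 ∅ A := by
  let a := Atom.var 0
  let b := Atom.var 1
  let r := Atom.var 2
  let 𝔅 := Set.range AtomicRule.atExp ∪ insert (AtomicRule.fact r) (Set.range (orElim r a b))
  have h𝔅 : 𝔅 ∈ Bases 2 := range_atExp_union_mem_bases (by
    rintro R (rfl | ⟨e, rfl⟩)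
    · simp [level_fact]
    · exact level_orElim r a b e)
  have sound : ∀ w ∈ fork r a b, r ∈ w → ∀ {e}, Derivable 𝔅 e → e ∈ w := by
    rintro w hw hrw e ⟨T, hT⟩
    refine hT.mem_world w hw ?_ (by simp)
    rintro R (⟨f, rfl⟩ | rfl | ⟨f, rfl⟩)
    · exact forced_atExp_fork (by simp [r]) (by simp [a]) (by simp [b]) f w
    · exact AtomicRule.forced_fact hrw
    · exact forced_orElim_fork r a b f w
  refine ⟨.or (.atom a) (.atom b), 𝔅, h𝔅, ⟨h𝔅, fun _ => ?_, fun h => absurd rfl h⟩, ?_⟩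
  · exact sHolds_or_of_orElim (r := r) (fun R hR => .inr (.inr hR))
      ⟨_, isDer_ax (.inr (.inl rfl))⟩
  · rintro ⟨D, 𝔍, -, hopen, hlabel, -, hvalid, -⟩
    have hD := hvalid (by rw [Tree.Closed, hopen, Finset.coe_empty])
    rw [hlabel] at hD
    rcases hD.or_derivable with h | h
    · have := sound {r, b} (.inr (.inr rfl)) (.inl rfl) h
      simp [a, b, r] at this
    · have := sound {r, a} (.inr (.inl rfl)) (.inl rfl) h
      simp [a, b, r] at this

theorem aConseq_of_peirce {n : ℕ} {𝔅 : Set AtomicRule} {r a b : Atom} (h𝔅 : 𝔅 ∈ Bases n)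
    (ha : peirce r a ∈ 𝔅) (hb : peirce r b ∈ 𝔅) :
    AConseq n 𝔅 {.imp (.atom r) (.or (.atom a) (.atom b))} (.atom r) := by
  set F : Formula := .imp (.atom r) (.or (.atom a) (.atom b)) with hF
  have hopen : (Tree.node (.atom r) none 1 fun _ => .asm F none).openAsm = {F} := by
    rw [Tree.openAsm_node_one, Tree.openAsm_asm]
  -- All reductions are taken because the derivation of `r` to be reached depends on the extension
  -- `ℭ` and on the argument substituted for `F`.
  refine ⟨.node (.atom r) none 1 fun _ => .asm F none, Set.univ, (Tree.isArg_asm F).node_one _,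
    by rw [hopen, Finset.coe_singleton], rfl, h𝔅, fun h => ?_, ?_⟩
  · rw [Tree.Closed, hopen] at h
    exact absurd h (Set.singleton_ne_empty F)
  · intro _ σ hσ 𝔍 h𝔍 ℭ hℭ hvalid
    obtain ⟨hcl, hval⟩ := hvalid F (by rw [hopen]; rfl)
    obtain ⟨E, hE⟩ : Derivable ℭ r := by
      rcases hval.imp_or_derivable hℭ.2 with h | h
      · exact derivable_of_peirce (hℭ.1 ha) h
      · exact derivable_of_peirce (hℭ.1 hb) h
    have hD : (Tree.node (.atom r) none 1 fun _ => σ F).IsArg := (hσ F).1.node_one _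
    exact ⟨E, reduces_of_closed h𝔍 ⟨hD, _, _, _, rfl⟩
      ((Tree.openAsm_node_one _ _).trans hcl) hE.isArg hE.closed hE.label_eq, hE⟩

theorem exists_aConseq_not_sConseq : ∃ (Γ : Finset Formula) (A : Formula), ∃ 𝔅 ∈ Bases 2,
    AConseq 2 𝔅 Γ A ∧ ¬ SConseq 2 𝔅 Γ A := by
  let a := Atom.var 0
  let b := Atom.var 1
  let r := Atom.var 2
  let X : Set AtomicRule := {peirce r a, peirce r b}
  have hX : ∀ R ∈ X, R.level ≤ 2 := by
    rintro R (rfl | rfl) <;> exact level_peirce r _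
  have h𝔅 : Set.range AtomicRule.atExp ∪ X ∈ Bases 2 := range_atExp_union_mem_bases hX
  refine ⟨{.imp (.atom r) (.or (.atom a) (.atom b))}, .atom r, _, h𝔅,
    aConseq_of_peirce h𝔅 (.inr (.inl rfl)) (.inr (.inr rfl)), fun ⟨_, _, h⟩ => ?_⟩
  obtain ⟨T, hT⟩ := h (Finset.singleton_ne_empty _)
    (Set.range AtomicRule.atExp ∪ (X ∪ Set.range (orElim r a b)))
    ⟨Set.union_subset_union_right _ Set.subset_union_left, range_atExp_union_mem_bases (by
      rintro R (hR | ⟨e, rfl⟩)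
      · exact hX R hR
      · exact level_orElim r a b e)⟩ (by
    intro B hB
    rw [Finset.mem_singleton.1 hB]
    exact fun ℭ hℭ hr => sHolds_or_of_orElim (fun R hR => hℭ.1 (.inr (.inr hR))) hr)
  -- The root forces every rule of the extended base, but no atom is true there.
  refine Set.notMem_empty r (hT.mem_world (𝒲 := fork r a b) ∅ (.inl rfl) ?_ (by simp))
  rintro R (⟨e, rfl⟩ | (rfl | rfl) | ⟨e, rfl⟩)
  · exact forced_atExp_fork (by simp [r]) (by simp [a]) (by simp [b]) e ∅
  · exact forced_peirce_fork (by simp [r, a]) (by simp [r, b]) (by simp [a, b]) (.inl rfl) ∅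
  · exact forced_peirce_fork (by simp [r, a]) (by simp [r, b]) (by simp [a, b]) (.inr rfl) ∅
  · exact forced_orElim_fork r a b e ∅

end PTS

theorem theorem10 :
    (¬ ∀ (Γ : Finset PTS.Formula) (A : PTS.Formula), ∀ 𝔅 ∈ PTS.Bases 2,
        PTS.SConseq 2 𝔅 Γ A → PTS.AConseq 2 𝔅 Γ A) ∧
    (¬ ∀ (Γ : Finset PTS.Formula) (A : PTS.Formula), ∀ 𝔅 ∈ PTS.Bases 2,
        PTS.AConseq 2 𝔅 Γ A → PTS.SConseq 2 𝔅 Γ A) := by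
  constructor
  · intro h
    obtain ⟨A, 𝔅, h𝔅, hs, ha⟩ := PTS.exists_sConseq_not_aConseq
    exact ha (h ∅ A 𝔅 h𝔅 hs)
  · intro h
    obtain ⟨Γ, A, 𝔅, h𝔅, ha, hs⟩ := PTS.exists_aConseq_not_sConseq
    exact hs (h Γ A 𝔅 h𝔅 ha)
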